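/- Let $\mathbb{F}$ be a field of characteristic zero and let $\mathfrak{L}$ be a finite-dimensional left Leibniz algebra over $\mathbb{F}$, i.e. a finite-dimensional vector space with a bilinear product satisfying $x(yz)=(xy)z+y(xz)$. Let $\mathrm{Leib}(\mathfrak{L})$ be the linear span of all squares $x^2$, $x\in\mathfrak{L}$, and suppose that $\mathfrak{L}$ is semi-simple, i.e. that $\mathrm{Leib}(\mathfrak{L})$ contains every solvable (two-sided) ideal of $\mathfrak{L}$. Then there is a subalgebra $\mathfrak{s}$ of $\mathfrak{L}$ with $\mathfrak{L}=\mathfrak{s}\oplus\mathrm{Leib}(\mathfrak{L})$ as vector spaces (a Levi factor). Let $\mathfrak{s}$ be any such subalgebra, acting on $\mathfrak{L}$ and its subspaces by left multiplication. Then there are decompositions $$\mathfrak{s}=\bigoplus_{i=1}^{p}\mathfrak{s}_i^{\oplus a_i},\qquad \mathrm{Leib}(\mathfrak{L})=\bigoplus_{j=1}^{t}M_j^{\oplus b_j}\qquad(a_i,b_j\ge 1)$$ of $\mathfrak{s}$ into a direct sum of simple ideals, where the $\mathfrak{s}_i$ are pairwise non-isomorphic as left $\mathfrak{s}$-modules,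 and of $\mathrm{Leib}(\mathfrak{L})$ into a direct sum of non-trivial irreducible left $\mathfrak{s}$-submodules, where the $M_j$ are pairwise non-isomorphic as left $\mathfrak{s}$-modules (here $N^{\oplus c}$ stands for an internal direct sum of $c$ such ideals, respectively submodules, each isomorphic to $N$ as a left $\mathfrak{s}$-module; $p=0$ and $t=0$ are allowed). For all such decompositions there is an isomorphism of $\mathbb{F}$-vector spaces $$\mathrm{Der}(\mathfrak{L})\cong\mathfrak{s}\oplus\bigoplus_{i=1}^{p}\bigoplus_{j=1}^{t}\mathrm{Hom}_{\mathfrak{s}}(\mathfrak{s}_i,M_j)^{\oplus a_ib_j}\oplus\bigoplus_{k=1}^{t}\mathrm{End}_{\mathfrak{s}}(M_k)^{\oplus b_k^2},$$ where $\mathrm{Der}(\mathfrak{L})$ is the space of linear maps $D$ with $D(xy)=D(x)y+xD(y)$, and $\mathrm{Hom}_{\mathfrak{s}}$ and $\mathrm{End}_{\mathfrak{s}}$ denote spaces of homomorphisms of left $\mathfrak{s}$-modules. -/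

import Mathlib

namespace Leibniz

section Basic

/-- The left Leibniz identity: every left multiplication operator is a derivation. The algebra
structure over `F` (a not necessarily associative bilinear product) is given by the standard
instances `NonUnitalNonAssocRing L`, `Module F L`, `IsScalarTower F L L`, `SMulCommClass F L L`. -/
def IsLeftLeibniz (L : Type*) [NonUnitalNonAssocRing L] : Prop :=
  ∀ x y z : L, x * (y * z) = (x * y) * z + y * (x * z)

variable (F : Type*) (L : Type*) [Field F] [NonUnitalNonAssocRing L] [Module F L]

/-- The Leibniz kernel `Leib(L)`: the linear span of all squares. -/
def leibnizKernel : Submodule F L :=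
  Submodule.span F (Set.range fun x : L => x * x)

variable {F L}

/-- Two-sided ideals. -/
def IsIdeal (I : Submodule F L) : Prop :=
  ∀ x : L, ∀ y ∈ I, x * y ∈ I ∧ y * x ∈ I

/-- The derived series `I, I I, (I I)(I I), …`, each term being the span of the products of two
elements of the preceding one. -/
def derivedSeries (I : Submodule F L) : ℕ → Submodule F L
  | 0 => I
  | n + 1 => Submodule.span F
      {z | ∃ x ∈ derivedSeries I n, ∃ y ∈ derivedSeries I n, z = x * y}

/-- Solvability of an ideal (as an algebra). -/
def IsSolvable (I : Submodule F L) : Prop :=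
  ∃ n : ℕ, derivedSeries I n = ⊥

variable (F L)

/-- A Leibniz algebra is semi-simple if its Leibniz kernel contains every solvable ideal. -/
def IsSemisimple : Prop :=
  ∀ I : Submodule F L, IsIdeal I → IsSolvable I → I ≤ leibnizKernel F L

/-- The vector space `Der(L)` of derivations of `L`. -/
def Der [IsScalarTower F L L] [SMulCommClass F L L] : Submodule F (L →ₗ[F] L) where
  carrier := {D | ∀ x y : L, D (x * y) = D x * y + x * D y}
  add_mem' := by
    intro D E hD hE x y
    simp only [LinearMap.add_apply, hD x y, hE x y, add_mul, mul_add]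
    abel
  zero_mem' := by
    intro x y
    simp
  smul_mem' := by
    intro c D hD x y
    simp only [LinearMap.smul_apply, hD x y, smul_add, smul_mul_assoc, mul_smul_comm]

end Basic

section Modules

variable {F : Type*} {L : Type*} [Field F] [NonUnitalNonAssocRing L] [Module F L]

/-- Left `s`-submodules of `L`, where the subalgebra `s` acts on `L` by left multiplication. -/
structure LeftSubmodule (s : NonUnitalSubalgebra F L) extends Submodule F L where
  mul_mem' : ∀ x ∈ s, ∀ m ∈ toSubmodule, x * m ∈ toSubmodule

variable {s : NonUnitalSubalgebra F L}

/-- The vector space `Hom_s(N, P)` of `s`-module homomorphisms. -/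
def homS [SMulCommClass F L L] (N P : LeftSubmodule s) :
    Submodule F (N.toSubmodule →ₗ[F] P.toSubmodule) where
  carrier := {f | ∀ (x : L) (hx : x ∈ s) (n : N.toSubmodule),
    f ⟨x * (n : L), N.mul_mem' x hx n n.2⟩ = ⟨x * (f n : L), P.mul_mem' x hx (f n) (f n).2⟩}
  add_mem' := by
    intro f g hf hg x hx n
    apply Subtype.ext
    simp [hf x hx n, hg x hx n, mul_add]
  zero_mem' := by
    intro x hx n
    apply Subtype.ext
    simp
  smul_mem' := by
    intro c f hf x hx n
    apply Subtype.ext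
    simp [hf x hx n, mul_smul_comm]

/-- Isomorphism of left `s`-modules. -/
def Isomorphic [SMulCommClass F L L] (N P : LeftSubmodule s) : Prop :=
  ∃ e : N.toSubmodule ≃ₗ[F] P.toSubmodule, (e : N.toSubmodule →ₗ[F] P.toSubmodule) ∈ homS N P

/-- A non-trivial irreducible left `s`-module: it is non-zero, it has no submodules besides `0`
and itself, and the action of `s` is not identically zero. -/
structure IsNontrivialIrreducible (N : LeftSubmodule s) : Prop where
  ne_bot : N.toSubmodule ≠ ⊥
  eq_bot_or_eq : ∀ P : LeftSubmodule s, P.toSubmodule ≤ N.toSubmodule →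
    P.toSubmodule = ⊥ ∨ P.toSubmodule = N.toSubmodule
  nontrivial_action : ∃ x ∈ s, ∃ n ∈ N.toSubmodule, x * n ≠ 0

/-- A simple ideal of `s`: a two-sided ideal of `s` which is simple as an algebra, i.e. its
product is not identically zero and its only ideals are `0` and itself. -/
structure IsSimpleIdeal (I : LeftSubmodule s) : Prop where
  le : I.toSubmodule ≤ s.toSubmodule
  mul_mem_right : ∀ x ∈ I.toSubmodule, ∀ y ∈ s, x * y ∈ I.toSubmodule
  non_abelian : ∃ x ∈ I.toSubmodule, ∃ y ∈ I.toSubmodule, x * y ≠ 0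
  eq_bot_or_eq : ∀ J : Submodule F L, J ≤ I.toSubmodule →
    (∀ x ∈ I.toSubmodule, ∀ y ∈ J, x * y ∈ J ∧ y * x ∈ J) → J = ⊥ ∨ J = I.toSubmodule

/-- `V = ⨁ⱼ (M j)^{⊕ b j}` is a decomposition of `V` into left `s`-submodules with the property
`P`, where the `M j` are submodules of `V` that are pairwise non-isomorphic as left `s`-modules,
and the multiplicities `b j` are positive. That is, `V` is the internal direct sum of submodules
`C j q` (`q = 0, …, b j - 1`) with property `P` such that `C j q` is isomorphic to `M j`. -/
structure IsDecomposition [SMulCommClass F L L] (P : LeftSubmodule s → Prop)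
    (V : Submodule F L) {t : ℕ} (M : Fin t → LeftSubmodule s) (b : Fin t → ℕ) : Prop where
  prop : ∀ j, P (M j)
  le : ∀ j, (M j).toSubmodule ≤ V
  pos : ∀ j, 0 < b j
  not_isomorphic : ∀ i j, i ≠ j → ¬ Isomorphic (M i) (M j)
  exists_copies : ∃ C : (j : Fin t) → Fin (b j) → LeftSubmodule s,
    (∀ j q, P (C j q) ∧ Isomorphic (C j q) (M j)) ∧
    iSupIndep (fun k : (j : Fin t) × Fin (b j) => (C k.1 k.2).toSubmodule) ∧
    (⨆ k : (j : Fin t) × Fin (b j), (C k.1 k.2).toSubmodule) = V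

end Modules

end Leibniz

/-! Left multiplication by an element of `Leib(L)` is zero, and semi-simplicity makes `Leib(L)`
exactly the left annihilator of `L`. So `L / Leib(L)` is the Lie algebra `g` of left multiplication
operators; its radical vanishes, since an abelian ideal of `g` pulls back to a solvable ideal of
`L`. The `g`-submodules of `L` are its left ideals.

Two classical facts about `g` carry the proof: Whitehead's first lemma, proved with a Casimir
operator and induction on dimension, and Weyl's theorem, deduced from it. By Weyl, `Leib(L)` has a
complementary left ideal, which is a Levi factor. Any Levi factor `s` acts on `L` as `g` does, so
`s` and `Leib(L)` split into minimal left ideals.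

A derivation `D` satisfies `[D, L_x] = L_{D x}`, hence induces a derivation of `g`, which is inner
by Whitehead. Subtracting a left multiplication by some `a ∈ s` leaves a derivation `E` with values
in `Leib(L)`; since `E(x) y = 0`, such a map is a derivation exactly when it is `s`-linear. Thus
`Der(L) ≅ s ⊕ Hom_s(s, Leib(L)) ⊕ End_s(Leib(L))`. Additivity of `Hom` and Schur's lemma then match
dimensions with the stated formula. -/

/-- A Lie ideal annihilating a nonzero vector of an irreducible Lie module acts trivially. -/
theorem LieIdeal.lie_eq_zero_of_exists_ne_zero {K g M : Type*} [Field K] [LieRing g] [LieAlgebra K g]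
    [AddCommGroup M] [Module K M] [LieRingModule g M] [LieModule K g M]
    [LieModule.IsIrreducible K g M] (J : LieIdeal K g)
    (hJ : ∃ m : M, m ≠ 0 ∧ ∀ x ∈ J, ⁅x, m⁆ = 0) : ∀ x ∈ J, ∀ m : M, ⁅x, m⁆ = 0 := by
  let N : LieSubmodule K g M :=
    { carrier := {m | ∀ x ∈ J, ⁅x, m⁆ = 0}
      add_mem' := fun {a b} ha hb x hx => by rw [lie_add, ha x hx, hb x hx, add_zero]
      zero_mem' := fun x _ => lie_zero x
      smul_mem' := fun c m hm x hx => by rw [lie_smul, hm x hx, smul_zero]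
      lie_mem := fun {y m} hm x hx => by
        rw [leibniz_lie, hm x hx, lie_zero, add_zero]
        exact hm _ (lie_mem_left K g J x y hx) }
  obtain ⟨m₀, h0, hm₀⟩ := hJ
  have hN : N = ⊤ := by
    refine (eq_bot_or_eq_top N).resolve_left fun h => ?_
    have : m₀ ∈ N := hm₀
    rw [h, LieSubmodule.mem_bot] at this
    exact h0 this
  intro x hx m
  have : m ∈ N := hN ▸ LieSubmodule.mem_top m
  exact this x hx

/-! ### Whitehead's first lemma and Weyl's theorem -/

section Whitehead

variable {K g M : Type*} [Field K] [LieRing g] [LieAlgebra K g] [AddCommGroup M] [Module K M]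

/-- For dual families with respect to an invariant form, the sum of the tensors
`e i ⊗ e' i` is invariant. -/
theorem LieModule.sum_lie_dual_eq_zero {ι : Type*} [Fintype ι] [DecidableEq ι]
    (B : LinearMap.BilinForm K g) (hinv : ∀ x y z : g, B ⁅x, y⁆ z = - B y ⁅x, z⁆)
    (h : LieIdeal K g) (e e' : ι → g) (he : ∀ i, e i ∈ h) (he' : ∀ i, e' i ∈ h)
    (hrepr : ∀ x ∈ h, x = ∑ i, B x (e' i) • e i) (hrepr' : ∀ x ∈ h, x = ∑ i, B (e i) x • e' i)
    (Φ : g →ₗ[K] g →ₗ[K] M) (x : g) :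
    ∑ i, (Φ ⁅x, e i⁆ (e' i) + Φ (e i) ⁅x, e' i⁆) = 0 := by
  have h1 : ∑ i, Φ ⁅x, e i⁆ (e' i) = ∑ i, ∑ j, B ⁅x, e i⁆ (e' j) • Φ (e j) (e' i) := by
    refine Finset.sum_congr rfl fun i _ => ?_
    conv_lhs => rw [hrepr _ (lie_mem_right K g h x (e i) (he i))]
    simp
  have h2 : ∑ i, Φ (e i) ⁅x, e' i⁆ = ∑ i, ∑ j, B (e j) ⁅x, e' i⁆ • Φ (e i) (e' j) := by
    refine Finset.sum_congr rfl fun i _ => ?_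
    conv_lhs => rw [hrepr' _ (lie_mem_right K g h x (e' i) (he' i))]
    simp
  -- The coefficients of `Φ (e i) (e' j)` in the two sums are `B ⁅x, e j⁆ (e' i)` and `B (e j) ⁅x,
  -- e' i⁆`, which are opposite by invariance.
  rw [Finset.sum_add_distrib, h1, h2, Finset.sum_comm, ← Finset.sum_add_distrib]
  refine Finset.sum_eq_zero fun i _ => ?_
  rw [← Finset.sum_add_distrib]
  refine Finset.sum_eq_zero fun j _ => ?_
  rw [hinv, neg_smul, neg_add_cancel]

variable [LieRingModule g M] [LieModule K g M]

/-- Triviality of the first cohomology is inherited by extensions of modules. -/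
theorem LieModule.exists_eq_lie_of_extension (N : LieSubmodule K g M)
    (hN : ∀ f : g →ₗ[K] N, (∀ x y, f ⁅x, y⁆ = ⁅x, f y⁆ - ⁅y, f x⁆) → ∃ m : N, ∀ x, f x = ⁅x, m⁆)
    (hQ : ∀ f : g →ₗ[K] M ⧸ N, (∀ x y, f ⁅x, y⁆ = ⁅x, f y⁆ - ⁅y, f x⁆) →
      ∃ m : M ⧸ N, ∀ x, f x = ⁅x, m⁆)
    (f : g →ₗ[K] M) (hf : ∀ x y, f ⁅x, y⁆ = ⁅x, f y⁆ - ⁅y, f x⁆) : ∃ m : M, ∀ x, f x = ⁅x, m⁆ := by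
  let q := LieSubmodule.Quotient.mk' N
  obtain ⟨m', hm'⟩ := hQ ((q : M →ₗ[K] M ⧸ N) ∘ₗ f) (fun x y => by simp [hf])
  obtain ⟨m, rfl⟩ := LieSubmodule.Quotient.surjective_mk' N m'
  -- Subtracting the coboundary of a lift of the solution in the quotient leaves a cocycle with
  -- values in `N`.
  let f₁ : g →ₗ[K] M := f - (LieModule.toEnd K g M : g →ₗ[K] Module.End K M).flip m
  have hf₁ : ∀ x, f₁ x = f x - ⁅x, m⁆ := fun x => rfl
  have hmem : ∀ x, f₁ x ∈ N.toSubmodule := fun x => by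
    have := hm' x
    rw [← LieModuleHom.map_lie, ← sub_eq_zero] at this
    have h2 : q (f x - ⁅x, m⁆) = 0 := by rw [map_sub]; exact this
    rwa [LieSubmodule.Quotient.mk_eq_zero] at h2
  obtain ⟨n, hn⟩ := hN (f₁.codRestrict N.toSubmodule hmem) (fun x y => by
    apply Subtype.ext
    change f₁ ⁅x, y⁆ = ⁅x, f₁ y⁆ - ⁅y, f₁ x⁆
    simp only [hf₁, hf, lie_sub, lie_lie]
    abel)
  refine ⟨m + n, fun x => ?_⟩
  have h : f x - ⁅x, m⁆ = ⁅x, (n : M)⁆ := congrArg Subtype.val (hn x)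
  rw [lie_add, ← h]
  abel

variable [CharZero K] [FiniteDimensional K g] [LieAlgebra.HasTrivialRadical K g]
  [FiniteDimensional K M]

variable (K g M) in
/-- An irreducible module of a semisimple Lie algebra is annihilated by an ideal on a complement
of which the trace form is nondegenerate. -/
theorem LieModule.exists_ideal_traceForm_nondegenerate [LieModule.IsIrreducible K g M] :
    ∃ h : LieIdeal K g, ((traceForm K g M).restrict h.toSubmodule).Nondegenerate ∧
      (h = ⊥ → (∀ (x : g) (m : M), ⁅x, m⁆ = 0) ∧ ⁅(⊤ : LieIdeal K g), (⊤ : LieIdeal K g)⁆ = ⊤) := by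
  have : Nontrivial M := nontrivial_of_isIrreducible K g M
  let r : LieIdeal K g :=
    { LinearMap.ker (traceForm K g M) with
      lie_mem := fun {x y} hy => by
        have hy : traceForm K g M y = 0 := hy
        change traceForm K g M ⁅x, y⁆ = 0
        ext z
        rw [traceForm_apply_lie_apply', hy]
        simp }
  have hr : ∀ x ∈ r, ∀ y, traceForm K g M x y = 0 := fun x hx y => by
    have hx : traceForm K g M x = 0 := hx
    simp [hx]
  have tf : traceForm K r M = 0 := by
    ext x y
    exact hr x x.2 y
  -- Cartan's criterion on the radical `r` of the trace form: `⁅r, r⁆` acts nilpotently, so it kills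
  -- a nonzero vector and, by irreducibility, all of `M`.
  have hnil := isNilpotent_derivedSeries_of_traceForm_eq_zero tf
  let J : LieIdeal K g := ⁅r, r⁆
  have hJ : ∀ x ∈ J, ∀ m : M, ⁅x, m⁆ = 0 := by
    apply LieIdeal.lie_eq_zero_of_exists_ne_zero (K := K)
    have := nontrivial_max_triv_of_isNilpotent K (LieAlgebra.derivedSeries K r 1) M
    obtain ⟨m, hm⟩ := exists_ne (0 : maxTrivSubmodule K (LieAlgebra.derivedSeries K r 1) M)
    refine ⟨m, fun h => hm (Subtype.ext h), fun x hx => ?_⟩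
    have hm' := m.2 ⟨⟨x, LieSubmodule.lie_le_left r r hx⟩, by
      rw [LieIdeal.derivedSeries_eq_derivedSeriesOfIdeal_comap, LieIdeal.mem_comap]
      exact hx⟩
    exact hm'
  have hcompl := J.isCompl_killingCompl
  refine ⟨J.killingCompl, ?_, ?_⟩
  · have hsymm : ((traceForm K g M).restrict J.killingCompl.toSubmodule).IsSymm :=
      ⟨fun x y => traceForm_comm K g M x y⟩
    refine LinearMap.IsRefl.nondegenerate_iff_separatingLeft hsymm.isRefl |>.2 ?_
    rintro ⟨x, hx⟩ hx0
    have hxr : x ∈ r := by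
      change traceForm K g M x = 0
      ext y
      obtain ⟨a, ha, b, hb, rfl⟩ : ∃ a ∈ J, ∃ b ∈ J.killingCompl, a + b = y := by
        have : y ∈ J ⊔ J.killingCompl := by rw [hcompl.sup_eq_top]; trivial
        exact (LieSubmodule.mem_sup J _ y).1 this
      have h1 : traceForm K g M x a = 0 := by
        have : toEnd K g M a = 0 := by ext m; exact hJ a ha m
        simp [traceForm_apply_apply, this]
      have h2 : traceForm K g M x b = 0 := hx0 ⟨b, hb⟩
      simp [h1, h2]
    -- This ideal is abelian, because its brackets lie in both `⁅r, r⁆ = J` and the Killing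
    -- complement of `J`.
    have hq : r ⊓ J.killingCompl = ⊥ := by
      apply (LieAlgebra.hasTrivialRadical_iff_no_abelian_ideals K g).1 inferInstance
      refine ⟨fun a b => Subtype.ext ?_⟩
      have h1 : ⁅(a : g), (b : g)⁆ ∈ J ⊓ J.killingCompl :=
        ⟨LieSubmodule.lie_mem_lie a.2.1 b.2.1, lie_mem_right K g _ _ _ b.2.2⟩
      rw [hcompl.inf_eq_bot] at h1
      exact h1
    have : x ∈ r ⊓ J.killingCompl := ⟨hxr, hx⟩
    rw [hq] at this
    exact Subtype.ext this
  · intro h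
    have hJt : J = ⊤ := by
      have := hcompl.sup_eq_top
      rwa [h, sup_bot_eq] at this
    refine ⟨fun x m => hJ x (hJt ▸ LieSubmodule.mem_top x) m, ?_⟩
    exact eq_top_iff.2 <| hJt.symm.le.trans <| LieSubmodule.mono_lie (le_top : r ≤ ⊤) (le_top : r ≤ ⊤)

/-- One-cocycles with values in an irreducible module are coboundaries, by the Casimir element. -/
theorem LieModule.exists_eq_lie_of_isIrreducible [LieModule.IsIrreducible K g M] (f : g →ₗ[K] M)
    (hf : ∀ x y, f ⁅x, y⁆ = ⁅x, f y⁆ - ⁅y, f x⁆) : ∃ m : M, ∀ x, f x = ⁅x, m⁆ := by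
  classical
  obtain ⟨h, hnd, htriv⟩ := exists_ideal_traceForm_nondegenerate K g M
  -- Here the action is trivial and `g` is perfect, so a cocycle, which kills brackets, is zero.
  by_cases hbot : h = ⊥
  · obtain ⟨h1, h2⟩ := htriv hbot
    refine ⟨0, fun x => ?_⟩
    have hx : x ∈ (⁅(⊤ : LieIdeal K g), (⊤ : LieIdeal K g)⁆ : LieIdeal K g).toSubmodule := by
      rw [h2]; trivial
    rw [LieSubmodule.lieIdeal_oper_eq_linear_span'] at hx
    rw [lie_zero]
    have : Submodule.span K {z | ∃ x ∈ (⊤ : LieIdeal K g), ∃ n ∈ (⊤ : LieIdeal K g), ⁅x, n⁆ = z}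
        ≤ LinearMap.ker f := by
      rw [Submodule.span_le]
      rintro _ ⟨a, -, b, -, rfl⟩
      simp [hf, h1]
    exact this hx
  let B := (traceForm K g M).restrict h.toSubmodule
  let b := Module.finBasis K h.toSubmodule
  let b' := B.dualBasis hnd b
  have hsymm : B.IsSymm := ⟨fun x y => traceForm_comm K g M x y⟩
  have hinv : ∀ x y z, traceForm K g M ⁅x, y⁆ z = - traceForm K g M y ⁅x, z⁆ :=
    fun x y z => traceForm_apply_lie_apply' K g M x y z
  have hrepr : ∀ x ∈ h, x = ∑ i, traceForm K g M x (b' i) • (b i : g) := fun x hx => by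
    have h1 := b.sum_repr ⟨x, hx⟩
    have h2 : ∀ i, b.repr ⟨x, hx⟩ i = B ⟨x, hx⟩ (b' i) := fun i => by
      rw [← LinearMap.BilinForm.dualBasis_repr_apply hnd b',
        LinearMap.BilinForm.dualBasis_dualBasis hnd hsymm b]
    simp only [h2] at h1
    have h3 := congrArg Subtype.val h1
    exact h3.symm.trans (by simp [B])
  have hrepr' : ∀ x ∈ h, x = ∑ i, traceForm K g M (b i) x • (b' i : g) := fun x hx => by
    have h1 := b'.sum_repr ⟨x, hx⟩
    have h2 : ∀ i, b'.repr ⟨x, hx⟩ i = B (b i) ⟨x, hx⟩ := fun i => by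
      rw [LinearMap.BilinForm.dualBasis_repr_apply hnd b, hsymm.eq]
    simp only [h2] at h1
    have h3 := congrArg Subtype.val h1
    exact h3.symm.trans (by simp [B])
  -- The Casimir operator: it commutes with `g` and has trace `dim h`, nonzero in characteristic
  -- zero, so irreducibility makes it injective.
  let c : Module.End K M := ∑ i, toEnd K g M (b i) * toEnd K g M (b' i)
  have hc : ∀ x m, c ⁅x, m⁆ = ⁅x, c m⁆ := fun x m => by
    let Φ : g →ₗ[K] g →ₗ[K] M :=
      LinearMap.mk₂ K (fun u v => ⁅u, ⁅v, m⁆⁆) (by simp) (by simp) (by simp) (by simp)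
    have := sum_lie_dual_eq_zero _ hinv h (fun i => (b i : g)) (fun i => (b' i : g))
      (fun i => (b i).2) (fun i => (b' i).2) hrepr hrepr' Φ x
    rw [← sub_eq_zero, ← neg_eq_zero, ← this]
    simp only [c, LinearMap.sum_apply, Module.End.mul_apply, toEnd_apply_apply, lie_sum,
      ← Finset.sum_sub_distrib, ← Finset.sum_neg_distrib]
    refine Finset.sum_congr rfl fun i _ => ?_
    simp [Φ]
  have htr : LinearMap.trace K M c = Module.finrank K h.toSubmodule := by
    simp only [c, map_sum]
    have : ∀ i, LinearMap.trace K M (toEnd K g M (b i) * toEnd K g M (b' i)) = 1 := fun i => by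
      have := LinearMap.BilinForm.apply_dualBasis_right hnd hsymm b i i
      rw [if_pos rfl] at this
      exact this
    simp [this]
  have hc0 : c ≠ 0 := by
    intro h0
    rw [h0, map_zero] at htr
    have : Module.finrank K h.toSubmodule = 0 := by exact_mod_cast htr.symm
    rw [Submodule.finrank_eq_zero, LieSubmodule.toSubmodule_eq_bot] at this
    exact hbot this
  let N : LieSubmodule K g M := { LinearMap.ker c with
    lie_mem := fun {x m} hm => by
      have hm : c m = 0 := hm
      change c ⁅x, m⁆ = 0
      rw [hc, hm, lie_zero] }
  have hN : N = ⊥ := (eq_bot_or_eq_top N).resolve_right fun hN => hc0 <| by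
    ext m
    have : m ∈ N := hN ▸ LieSubmodule.mem_top m
    exact this
  have hinj : Function.Injective c := by
    rw [← LinearMap.ker_eq_bot]
    exact congrArg LieSubmodule.toSubmodule hN
  -- If `f x = ⁅x, m⁆` for all `x`, then `c m` must equal this sum; invertibility of `c` recovers
  -- `m`.
  obtain ⟨m, hm⟩ := (LinearMap.injective_iff_surjective.1 hinj) (∑ i, ⁅(b i : g), f (b' i)⁆)
  refine ⟨m, fun x => hinj ?_⟩
  rw [hc, hm]
  let Φ : g →ₗ[K] g →ₗ[K] M :=
    LinearMap.mk₂ K (fun u v => ⁅u, f v⁆) (by simp) (by simp) (by simp) (by simp)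
  have := sum_lie_dual_eq_zero _ hinv h (fun i => (b i : g)) (fun i => (b' i : g))
      (fun i => (b i).2) (fun i => (b' i).2) hrepr hrepr' Φ x
  rw [← sub_eq_zero, ← neg_eq_zero, ← this]
  simp only [c, LinearMap.sum_apply, Module.End.mul_apply, toEnd_apply_apply, lie_sum,
    ← Finset.sum_sub_distrib, ← Finset.sum_neg_distrib]
  refine Finset.sum_congr rfl fun i _ => ?_
  simp only [Φ, LinearMap.mk₂_apply, hf, lie_sub]
  rw [leibniz_lie x]
  abel

/-- **Whitehead's first lemma**: one-cocycles of a semisimple Lie algebra with values in a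
finite-dimensional module are coboundaries. -/
theorem LieModule.exists_eq_lie_of_cocycle (f : g →ₗ[K] M)
    (hf : ∀ x y, f ⁅x, y⁆ = ⁅x, f y⁆ - ⁅y, f x⁆) : ∃ m : M, ∀ x, f x = ⁅x, m⁆ := by
  induction hn : Module.finrank K M using Nat.strong_induction_on generalizing M with
  | _ n ih =>
    subst hn
    rcases subsingleton_or_nontrivial M with h | h
    · exact ⟨0, fun x => Subsingleton.elim _ _⟩
    by_cases hirr : ∃ N : LieSubmodule K g M, N ≠ ⊥ ∧ N ≠ ⊤
    · obtain ⟨N, hb, ht⟩ := hirr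
      have h1 : Module.finrank K N < Module.finrank K M :=
        Submodule.finrank_lt (s := N.toSubmodule) (by simpa using ht)
      have h2 : Module.finrank K (M ⧸ N) < Module.finrank K M := by
        have h3 := Submodule.finrank_quotient_add_finrank N.toSubmodule
        have h4 : Module.finrank K N.toSubmodule ≠ 0 := by
          rw [Ne, Submodule.finrank_eq_zero]; simpa using hb
        change Module.finrank K (M ⧸ N.toSubmodule) < _
        omega
      have : FiniteDimensional K N := inferInstanceAs (FiniteDimensional K N.toSubmodule)
      have : FiniteDimensional K (M ⧸ N) := inferInstanceAs (FiniteDimensional K (M ⧸ N.toSubmodule))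
      exact exists_eq_lie_of_extension N (fun f hf => ih _ h1 f hf rfl)
        (fun f hf => ih _ h2 f hf rfl) f hf
    · push Not at hirr
      have : LieModule.IsIrreducible K g M :=
        LieModule.IsIrreducible.mk fun N hN => hirr N hN
      exact exists_eq_lie_of_isIrreducible f hf

/-- **Weyl's theorem** on complete reducibility. -/
theorem LieModule.complementedLattice_lieSubmodule : ComplementedLattice (LieSubmodule K g M) := by
  refine ⟨fun N => ?_⟩
  obtain ⟨p, hp⟩ := N.toSubmodule.subtype.exists_leftInverse_of_injective (by simp)
  have hp : ∀ n : N, p n = n := fun n => LinearMap.congr_fun hp n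
  let p' : M →ₗ[K] N := p
  -- For a linear projection `p'` onto `N`, the map `x ↦ ⁅x, p'⁆` is a cocycle with values in the
  -- maps vanishing on `N`. Correcting `p'` by such a map `φ` makes it equivariant without changing
  -- it on `N`.
  let H : LieSubmodule K g (M →ₗ[K] N) :=
    { carrier := {φ | ∀ n ∈ N, φ n = 0}
      add_mem' := fun {a b} ha hb n hn => by simp [ha n hn, hb n hn]
      zero_mem' := fun n _ => rfl
      smul_mem' := fun c φ hφ n hn => by simp [hφ n hn]
      lie_mem := fun {x φ} hφ n hn => by
        rw [LieHom.lie_apply, hφ n hn, hφ _ (N.lie_mem hn), lie_zero, sub_zero] }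
  have hH : ∀ x : g, ⁅x, p'⁆ ∈ H := fun x n hn => by
    rw [LieHom.lie_apply, hp ⟨n, hn⟩, hp ⟨_, N.lie_mem hn⟩]
    apply Subtype.ext
    simp
  have : FiniteDimensional K N := inferInstanceAs (FiniteDimensional K N.toSubmodule)
  have : FiniteDimensional K H := inferInstanceAs (FiniteDimensional K H.toSubmodule)
  let f : g →ₗ[K] H := LinearMap.codRestrict H.toSubmodule
    ((toEnd K g (M →ₗ[K] N) : g →ₗ[K] Module.End K (M →ₗ[K] N)).flip p') hH
  have hfx : ∀ x, (f x : M →ₗ[K] N) = ⁅x, p'⁆ := fun x => rfl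
  obtain ⟨φ, hφ⟩ := exists_eq_lie_of_cocycle f (fun x y => by
    apply Subtype.ext
    simp only [LieSubmodule.coe_sub, LieSubmodule.coe_bracket, hfx, lie_lie])
  have hψ : ∀ (x : g) (m : M), (p' - φ.1) ⁅x, m⁆ = ⁅x, (p' - φ.1) m⁆ := fun x m => by
    have h1 : ⁅x, p' - φ.1⁆ = 0 := by
      rw [lie_sub, ← hfx, hφ]
      simp
    have h2 := LinearMap.congr_fun h1 m
    rw [LieHom.lie_apply] at h2
    exact (sub_eq_zero.1 h2).symm
  have hψN : ∀ n : N, (p' - φ.1) n = n := fun n => by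
    rw [LinearMap.sub_apply, φ.2 n n.2, sub_zero]
    exact hp n
  refine ⟨{ LinearMap.ker (p' - φ.1) with
    lie_mem := fun {x m} hm => by
      have hm : (p' - φ.1) m = 0 := hm
      change (p' - φ.1) ⁅x, m⁆ = 0
      rw [hψ, hm, lie_zero] }, ?_⟩
  rw [← LieSubmodule.isCompl_toSubmodule]
  exact LinearMap.isCompl_of_proj (p := N.toSubmodule) (f := p' - φ.1) hψN

end Whitehead

namespace Leibniz

/-! ### The Lie algebra of left multiplications and its radical -/

section Structure

variable {F L : Type*} [Field F] [NonUnitalNonAssocRing L] [Module F L]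

/-- For a square, the identity `z(zy) = (zz)y + z(zy)` forces `(zz)y = 0`. -/
theorem leibnizKernel_mul_eq_zero [IsScalarTower F L L] (hL : IsLeftLeibniz L) {x : L}
    (hx : x ∈ leibnizKernel F L) (y : L) : x * y = 0 := by
  induction hx using Submodule.span_induction with
  | mem x h =>
    obtain ⟨z, rfl⟩ := h
    have := hL z z y
    rwa [right_eq_add] at this
  | zero => exact zero_mul y
  | add a b _ _ ha hb => rw [add_mul, ha, hb, add_zero]
  | smul c a _ ha => rw [smul_mul_assoc, ha, smul_zero]

theorem mul_add_mul_mem_leibnizKernel (x y : L) : x * y + y * x ∈ leibnizKernel F L := by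
  have h : ∀ z : L, z * z ∈ leibnizKernel F L := fun z => Submodule.subset_span ⟨z, rfl⟩
  have := sub_mem (sub_mem (h (x + y)) (h x)) (h y)
  convert this using 1
  simp only [add_mul, mul_add]
  abel

theorem mul_mem_leibnizKernel [SMulCommClass F L L] (hL : IsLeftLeibniz L) (x : L) {y : L}
    (hy : y ∈ leibnizKernel F L) : x * y ∈ leibnizKernel F L := by
  induction hy using Submodule.span_induction with
  | mem y h =>
    obtain ⟨z, rfl⟩ := h
    simp only [hL x z z]
    exact mul_add_mul_mem_leibnizKernel _ _
  | zero => rw [mul_zero]; exact zero_mem _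
  | add a b _ _ ha hb => rw [mul_add]; exact add_mem ha hb
  | smul c a _ ha => rw [mul_smul_comm]; exact Submodule.smul_mem _ c ha

theorem derivedSeries_one_le {I J : Submodule F L} (h : ∀ x ∈ I, ∀ y ∈ I, x * y ∈ J) :
    derivedSeries I 1 ≤ J := by
  refine Submodule.span_le.2 ?_
  rintro _ ⟨x, hx, y, hy, rfl⟩
  exact h x hx y hy

/-- An ideal all of whose products lie in the Leibniz kernel is solvable. -/
theorem isSolvable_of_mul_mem_leibnizKernel [IsScalarTower F L L] (hL : IsLeftLeibniz L)
    {I : Submodule F L} (h : ∀ x ∈ I, ∀ y ∈ I, x * y ∈ leibnizKernel F L) : IsSolvable I := by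
  refine ⟨2, eq_bot_iff.2 <| Submodule.span_le.2 ?_⟩
  rintro _ ⟨x, hx, y, hy, rfl⟩
  exact leibnizKernel_mul_eq_zero hL (derivedSeries_one_le h hx) y

variable [IsScalarTower F L L] [SMulCommClass F L L]

/-- The left annihilator is a two-sided ideal with zero product, hence solvable, so semi-simplicity
puts it inside the kernel. -/
theorem mem_leibnizKernel_iff (hL : IsLeftLeibniz L) (hss : IsSemisimple F L) {x : L} :
    x ∈ leibnizKernel F L ↔ ∀ y, x * y = 0 := by
  refine ⟨fun hx y => leibnizKernel_mul_eq_zero hL hx y, fun hx => ?_⟩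
  let Z : Submodule F L := LinearMap.ker (LinearMap.mul F L)
  have hZ : ∀ z, z ∈ Z ↔ ∀ y, z * y = 0 := fun z => by
    simp [Z, LinearMap.ext_iff]
  refine hss Z (fun a b hb => ?_) ⟨1, ?_⟩ ((hZ x).2 hx)
  · simp only [hZ] at hb ⊢
    refine ⟨fun y => ?_, fun y => ?_⟩
    · have := hL a b y
      rwa [hb, hb, mul_zero, add_zero, eq_comm] at this
    · rw [hb, zero_mul]
  · refine eq_bot_iff.2 (derivedSeries_one_le fun a ha b _ => ?_)
    rw [(hZ a).1 ha]
    exact zero_mem _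

attribute [local instance] LieRing.ofAssociativeRing

variable (F) in
/-- The Lie algebra of left multiplication operators of a left Leibniz algebra. -/
def leftMul (hL : IsLeftLeibniz L) : LieSubalgebra F (Module.End F L) :=
  { LinearMap.range (LinearMap.mul F L) with
    lie_mem' := by
      rintro _ _ ⟨x, rfl⟩ ⟨y, rfl⟩
      refine ⟨x * y, ?_⟩
      ext z
      simp [LieRing.of_associative_ring_bracket, hL x y z] }

variable (F) in
/-- The canonical map of a left Leibniz algebra onto its Lie algebra of left multiplications. -/
def toLeftMul (hL : IsLeftLeibniz L) : L →ₗ[F] leftMul F hL :=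
  (LinearMap.mul F L).rangeRestrict

theorem toLeftMul_surjective (hL : IsLeftLeibniz L) : Function.Surjective (toLeftMul F hL) :=
  LinearMap.surjective_rangeRestrict _

theorem toLeftMul_lie (hL : IsLeftLeibniz L) (x y : L) : ⁅toLeftMul F hL x, y⁆ = x * y := rfl

theorem toLeftMul_mul (hL : IsLeftLeibniz L) (x y : L) :
    toLeftMul F hL (x * y) = ⁅toLeftMul F hL x, toLeftMul F hL y⁆ := by
  apply Subtype.ext
  ext z
  change x * y * z = x * (y * z) - y * (x * z)
  rw [hL x y z]
  abel

theorem toLeftMul_eq_zero_iff (hL : IsLeftLeibniz L) (hss : IsSemisimple F L) {x : L} :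
    toLeftMul F hL x = 0 ↔ x ∈ leibnizKernel F L := by
  rw [mem_leibnizKernel_iff hL hss]
  constructor
  · intro h y
    rw [← toLeftMul_lie (F := F) hL, h, zero_lie]
  · intro h
    apply Subtype.ext
    ext y
    exact h y

/-- The preimage in `L` of an abelian ideal is an ideal whose products lie in the Leibniz kernel. It
is therefore solvable, lies in that kernel, and maps to zero. -/
theorem hasTrivialRadical_leftMul (hL : IsLeftLeibniz L) (hss : IsSemisimple F L)
    [FiniteDimensional F L] : LieAlgebra.HasTrivialRadical F (leftMul F hL) := by
  rw [LieAlgebra.hasTrivialRadical_iff_no_abelian_ideals]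
  intro I hI
  let J : Submodule F L := I.toSubmodule.comap (toLeftMul F hL)
  have hmem : ∀ x, x ∈ J ↔ toLeftMul F hL x ∈ I := fun x => Iff.rfl
  have hJ : J ≤ leibnizKernel F L := by
    refine hss J (fun x y hy => ?_) (isSolvable_of_mul_mem_leibnizKernel hL fun x hx y hy => ?_)
    · rw [hmem] at hy
      rw [hmem, hmem, toLeftMul_mul, toLeftMul_mul]
      exact ⟨lie_mem_right F _ I _ _ hy, lie_mem_left F _ I _ _ hy⟩
    · rw [← toLeftMul_eq_zero_iff hL hss, toLeftMul_mul]
      exact congrArg Subtype.val (hI.trivial ⟨_, hx⟩ ⟨_, hy⟩)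
  rw [eq_bot_iff]
  intro z hz
  obtain ⟨x, rfl⟩ := toLeftMul_surjective hL z
  rw [LieSubmodule.mem_bot, toLeftMul_eq_zero_iff hL hss]
  exact hJ hz

/-- A left ideal, as a module over the left multiplications. -/
def leftIdeal (hL : IsLeftLeibniz L) (N : Submodule F L) (hN : ∀ x, ∀ m ∈ N, x * m ∈ N) :
    LieSubmodule F (leftMul F hL) L :=
  { N with
    lie_mem := fun {x m} hm => by
      obtain ⟨x, rfl⟩ := toLeftMul_surjective hL x
      exact hN x m hm }

theorem mul_mem_lieSubmodule (hL : IsLeftLeibniz L) (N : LieSubmodule F (leftMul F hL) L) (x : L)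
    {m : L} (hm : m ∈ N) : x * m ∈ N := by
  rw [← toLeftMul_lie (F := F) hL]
  exact N.lie_mem hm

variable [CharZero F] [FiniteDimensional F L]

/-- The lattice of left ideals of a semisimple left Leibniz algebra is complemented. -/
theorem complementedLattice_leftMul (hL : IsLeftLeibniz L) (hss : IsSemisimple F L) :
    ComplementedLattice (LieSubmodule F (leftMul F hL) L) := by
  have := hasTrivialRadical_leftMul hL hss
  exact LieModule.complementedLattice_lieSubmodule

/-- **Levi decomposition** of a semisimple left Leibniz algebra. -/
theorem exists_isCompl_leibnizKernel (hL : IsLeftLeibniz L) (hss : IsSemisimple F L) :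
    ∃ s : NonUnitalSubalgebra F L, IsCompl s.toSubmodule (leibnizKernel F L) := by
  have := complementedLattice_leftMul hL hss
  obtain ⟨N, hN⟩ := exists_isCompl
    (leftIdeal hL (leibnizKernel F L) fun x _ hm => mul_mem_leibnizKernel hL x hm)
  rw [← LieSubmodule.isCompl_toSubmodule] at hN
  -- A left ideal is closed under multiplication, so the complement is already a subalgebra.
  exact ⟨{ N.toSubmodule with mul_mem' := fun {x y} _ hy => mul_mem_lieSubmodule hL N x hy },
    hN.symm⟩

/-- Every left ideal is a finite direct sum of minimal left ideals. -/
theorem exists_iSupIndep_isAtom (hL : IsLeftLeibniz L) (hss : IsSemisimple F L)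
    (V : LieSubmodule F (leftMul F hL) L) :
    ∃ (n : ℕ) (C : Fin n → LieSubmodule F (leftMul F hL) L), (∀ i, IsAtom (C i)) ∧
      (∀ i, C i ≤ V) ∧ iSupIndep (fun i => (C i).toSubmodule) ∧
      ⨆ i, (C i).toSubmodule = V.toSubmodule := by
  have := complementedLattice_leftMul hL hss
  obtain ⟨A, hA, hV, hat⟩ := exists_sSupIndep_of_sSup_atoms V (by
    simpa only [and_comm] using sSup_atoms_le_eq V)
  have hfin := WellFoundedGT.finite_of_sSupIndep hA
  have := hfin.to_subtype
  let e := Finite.equivFin A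
  refine ⟨Nat.card A, fun i => (e.symm i).1, fun i => hat (e.symm i).2,
    fun i => hV ▸ le_sSup (e.symm i).2, ?_, ?_⟩
  · rw [LieSubmodule.iSupIndep_toSubmodule]
    exact ((sSupIndep_iff A).1 hA).comp e.symm.injective
  · rw [e.symm.iSup_comp (g := fun a : A => (a.1).toSubmodule), ← LieSubmodule.iSup_toSubmodule,
      ← sSup_eq_iSup', hV]

end Structure

end Leibniz

namespace Leibniz

attribute [local instance] LieRing.ofAssociativeRing

/-! ### Levi factors and minimal left ideals -/

section Levi

theorem exists_add_of_isCompl {F L : Type*} [Field F] [AddCommGroup L] [Module F L]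
    {p q : Submodule F L} (h : IsCompl p q) (x : L) :
    ∃ a ∈ p, ∃ b ∈ q, x = a + b := by
  have : x ∈ p ⊔ q := h.sup_eq_top ▸ Submodule.mem_top
  obtain ⟨a, ha, b, hb, h⟩ := Submodule.mem_sup.1 this
  exact ⟨a, ha, b, hb, h.symm⟩

variable {F L : Type*} [Field F] [NonUnitalNonAssocRing L] [Module F L]
  {s : NonUnitalSubalgebra F L}

/-- The sum `xy + yx` lies in both `s` and the Leibniz kernel, so it vanishes: a Levi factor is
anticommutative. -/
theorem mul_eq_neg_mul (hs : IsCompl s.toSubmodule (leibnizKernel F L)) {x y : L} (hx : x ∈ s)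
    (hy : y ∈ s) : x * y = -(y * x) := by
  rw [← add_eq_zero_iff_eq_neg]
  exact Submodule.disjoint_def.1 hs.disjoint _ (add_mem (s.mul_mem hx hy) (s.mul_mem hy hx))
    (mul_add_mul_mem_leibnizKernel x y)

variable [IsScalarTower F L L]

/-- An element acts through its component in `s`. This identifies `s`-submodules of `L` with left
ideals. -/
theorem exists_mem_mul_eq (hL : IsLeftLeibniz L) (hs : IsCompl s.toSubmodule (leibnizKernel F L))
    (x : L) : ∃ a ∈ s, ∀ y, x * y = a * y := by
  obtain ⟨a, ha, b, hb, rfl⟩ := exists_add_of_isCompl hs x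
  exact ⟨a, ha, fun y => by rw [add_mul, leibnizKernel_mul_eq_zero hL hb, add_zero]⟩

theorem LeftSubmodule.mul_mem (hL : IsLeftLeibniz L)
    (hs : IsCompl s.toSubmodule (leibnizKernel F L)) (N : LeftSubmodule s) (x : L) {m : L}
    (hm : m ∈ N.toSubmodule) : x * m ∈ N.toSubmodule := by
  obtain ⟨a, ha, h⟩ := exists_mem_mul_eq hL hs x
  rw [h]
  exact N.mul_mem' a ha m hm

variable [SMulCommClass F L L]

variable (s) in
/-- Left ideals, as modules over a subalgebra. -/
def ofLeftIdeal {hL : IsLeftLeibniz L} (N : LieSubmodule F (leftMul F hL) L) : LeftSubmodule s :=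
  { N.toSubmodule with mul_mem' := fun x _ _ hm => mul_mem_lieSubmodule hL N x hm }

theorem eq_bot_or_eq_of_isAtom {hL : IsLeftLeibniz L} {A : LieSubmodule F (leftMul F hL) L}
    (hA : IsAtom A) (P : Submodule F L) (hP : ∀ x, ∀ m ∈ P, x * m ∈ P) (hPA : P ≤ A.toSubmodule) :
    P = ⊥ ∨ P = A.toSubmodule := by
  have h : leftIdeal hL P hP ≤ A := hPA
  rcases hA.le_iff.1 h with h | h
  · exact Or.inl (congrArg LieSubmodule.toSubmodule h)
  · exact Or.inr (congrArg LieSubmodule.toSubmodule h)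

variable [CharZero F] [FiniteDimensional F L]

theorem isNontrivialIrreducible_of_isAtom {hL : IsLeftLeibniz L} (hss : IsSemisimple F L)
    (hs : IsCompl s.toSubmodule (leibnizKernel F L)) {A : LieSubmodule F (leftMul F hL) L}
    (hA : IsAtom A) (hAL : A.toSubmodule ≤ leibnizKernel F L) :
    IsNontrivialIrreducible (ofLeftIdeal s A) where
  ne_bot h := hA.1 ((LieSubmodule.toSubmodule_eq_bot A).1 h)
  eq_bot_or_eq P hP := eq_bot_or_eq_of_isAtom hA P.toSubmodule (fun x _ => P.mul_mem hL hs x) hP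
  nontrivial_action := by
    by_contra! h
    have hLA : ∀ x, ∀ n ∈ A, x * n = 0 := fun x n hn => by
      obtain ⟨a, ha, hxa⟩ := exists_mem_mul_eq hL hs x
      rw [hxa]
      exact h a ha n hn
    have := complementedLattice_leftMul hL hss
    -- If `L` kills `A`, the square of `a + n` is `(a + n)n ∈ N`, so `N` contains the Leibniz kernel
    -- and hence `A`, a contradiction.
    obtain ⟨N, hN⟩ := exists_isCompl A
    rw [← LieSubmodule.isCompl_toSubmodule] at hN
    have hle : leibnizKernel F L ≤ N.toSubmodule := by
      refine Submodule.span_le.2 ?_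
      rintro _ ⟨x, rfl⟩
      obtain ⟨a, ha, n, hn, rfl⟩ := exists_add_of_isCompl hN x
      simp only [mul_add, hLA _ a ha, zero_add]
      exact mul_mem_lieSubmodule hL N _ hn
    refine hA.1 ((LieSubmodule.toSubmodule_eq_bot A).1 ?_)
    rw [← le_bot_iff, ← hN.inf_eq_bot]
    exact le_inf le_rfl (hAL.trans hle)

theorem isSimpleIdeal_of_isAtom {hL : IsLeftLeibniz L} (hss : IsSemisimple F L)
    (hs : IsCompl s.toSubmodule (leibnizKernel F L)) {A : LieSubmodule F (leftMul F hL) L}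
    (hA : IsAtom A) (hAs : A.toSubmodule ≤ s.toSubmodule) :
    IsSimpleIdeal (ofLeftIdeal s A) where
  le := hAs
  mul_mem_right x hx y hy := by
    rw [mul_eq_neg_mul hs (hAs hx) hy]
    exact neg_mem (mul_mem_lieSubmodule hL A y hx)
  non_abelian := by
    by_contra! h
    -- If `A` had zero product, `A + Leib(L)` would be a solvable ideal.
    have hA0 : A.toSubmodule ≤ leibnizKernel F L := by
      refine le_sup_left.trans <| hss (A.toSubmodule ⊔ leibnizKernel F L) (fun x z hz => ?_)
        (isSolvable_of_mul_mem_leibnizKernel hL fun x hx y hy => ?_)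
      · have h1 : x * z ∈ A.toSubmodule ⊔ leibnizKernel F L := by
          obtain ⟨a, ha, l, hl, rfl⟩ := Submodule.mem_sup.1 hz
          rw [mul_add]
          exact Submodule.add_mem_sup (mul_mem_lieSubmodule hL A x ha)
            (mul_mem_leibnizKernel hL x hl)
        refine ⟨h1, ?_⟩
        have := sub_mem (Submodule.mem_sup_right (S := A.toSubmodule)
          (mul_add_mul_mem_leibnizKernel (F := F) x z)) h1
        rwa [add_sub_cancel_left] at this
      · obtain ⟨a, ha, l, hl, rfl⟩ := Submodule.mem_sup.1 hx
        obtain ⟨b, hb, m, hm, rfl⟩ := Submodule.mem_sup.1 hy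
        rw [add_mul, leibnizKernel_mul_eq_zero hL hl, add_zero, mul_add, h a ha b hb, zero_add]
        exact mul_mem_leibnizKernel hL a hm
    refine hA.1 ((LieSubmodule.toSubmodule_eq_bot A).1 ?_)
    rw [← le_bot_iff, ← hs.inf_eq_bot]
    exact le_inf hAs hA0
  eq_bot_or_eq J hJ hideal := by
    refine eq_bot_or_eq_of_isAtom hA J (fun x y hy => ?_) hJ
    have hyA : y ∈ A := hJ hy
    obtain ⟨t, ht, hx⟩ := exists_mem_mul_eq hL hs x
    have := complementedLattice_leftMul hL hss
    -- The `N`-component `n` of `t` stays in `s`, and anticommutativity puts `n * y` in `A ∩ N = 0`.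
    -- So only the `A`-component acts, and an ideal of `A` is a left ideal of `L`.
    obtain ⟨N, hN⟩ := exists_isCompl A
    rw [← LieSubmodule.isCompl_toSubmodule] at hN
    obtain ⟨a, ha, n, hn, rfl⟩ := exists_add_of_isCompl hN t
    have hns : n ∈ s := by simpa using sub_mem ht (hAs ha)
    have hny : n * y = 0 := by
      refine Submodule.disjoint_def.1 hN.disjoint _ (mul_mem_lieSubmodule hL A n hyA) ?_
      rw [mul_eq_neg_mul hs hns (hAs hyA)]
      exact neg_mem (mul_mem_lieSubmodule hL N y hn)
    rw [hx, add_mul, hny, add_zero]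
    exact (hideal a ha y hy).1

end Levi

/-! ### Isomorphism classes of summands -/

section Decomposition

variable {F L : Type*} [Field F] [NonUnitalNonAssocRing L] [Module F L]
  [SMulCommClass F L L] {s : NonUnitalSubalgebra F L}

theorem mem_homS_symm {N P : LeftSubmodule s} {e : N.toSubmodule ≃ₗ[F] P.toSubmodule}
    (he : (e : N.toSubmodule →ₗ[F] P.toSubmodule) ∈ homS N P) :
    (e.symm : P.toSubmodule →ₗ[F] N.toSubmodule) ∈ homS P N := by
  intro x hx p
  apply e.injective
  have := he x hx (e.symm p)
  simp only [LinearEquiv.coe_coe, LinearEquiv.apply_symm_apply] at this ⊢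
  rw [this]

theorem mem_homS_comp {N P Q : LeftSubmodule s} {f : P.toSubmodule →ₗ[F] Q.toSubmodule}
    {g : N.toSubmodule →ₗ[F] P.toSubmodule} (hf : f ∈ homS P Q) (hg : g ∈ homS N P) :
    f ∘ₗ g ∈ homS N Q := by
  intro x hx n
  simp only [LinearMap.comp_apply, hg x hx n]
  exact hf x hx (g n)

theorem Isomorphic.refl (N : LeftSubmodule s) : Isomorphic N N :=
  ⟨LinearEquiv.refl F _, fun _ _ _ => rfl⟩

theorem Isomorphic.symm {N P : LeftSubmodule s} : Isomorphic N P → Isomorphic P N :=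
  fun ⟨e, he⟩ => ⟨e.symm, mem_homS_symm he⟩

theorem Isomorphic.trans {N P Q : LeftSubmodule s} :
    Isomorphic N P → Isomorphic P Q → Isomorphic N Q :=
  fun ⟨e, he⟩ ⟨f, hf⟩ => ⟨e.trans f, mem_homS_comp hf he⟩

/-- Grouping the summands of a direct sum by isomorphism classes. -/
theorem exists_isDecomposition {P : LeftSubmodule s → Prop} {V : Submodule F L} {n : ℕ}
    (C : Fin n → LeftSubmodule s) (hP : ∀ i, P (C i))
    (hC : iSupIndep fun i => (C i).toSubmodule) (hV : ⨆ i, (C i).toSubmodule = V) :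
    ∃ (t : ℕ) (M : Fin t → LeftSubmodule s) (b : Fin t → ℕ), IsDecomposition P V M b := by
  classical
  let r : Setoid (Fin n) := ⟨fun i j => Isomorphic (C i) (C j),
    fun i => Isomorphic.refl _, Isomorphic.symm, Isomorphic.trans⟩
  let eQ := Fintype.equivFin (Quotient r)
  let cl : Fin n → Fin (Fintype.card (Quotient r)) := fun i => eQ (Quotient.mk r i)
  let rep : Fin (Fintype.card (Quotient r)) → Fin n := fun j => (eQ.symm j).out
  have hrep : ∀ j, cl (rep j) = j := fun j => by simp [cl, rep]
  have hcl : ∀ i j, cl i = cl j → Isomorphic (C i) (C j) := fun i j h =>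
    Quotient.exact (eQ.injective h)
  have hcl' : ∀ i j, Isomorphic (C i) (C j) → cl i = cl j := fun i j h =>
    congrArg eQ (Quotient.sound h)
  let eF := fun j => Fintype.equivFin {i // cl i = j}
  let σ : ((j : Fin (Fintype.card (Quotient r))) × Fin (Fintype.card {i // cl i = j})) ≃ Fin n :=
    (Equiv.sigmaCongrRight fun j => (eF j).symm).trans (Equiv.sigmaFiberEquiv cl)
  refine ⟨_, fun j => C (rep j), fun j => Fintype.card {i // cl i = j}, fun j => hP _,
    fun j => hV ▸ le_iSup (fun i => (C i).toSubmodule) _,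
    fun j => Fintype.card_pos_iff.2 ⟨⟨rep j, hrep j⟩⟩, fun i j hij h => hij ?_,
    fun j q => C (σ ⟨j, q⟩), fun j q => ⟨hP _, hcl _ _ ?_⟩, ?_, ?_⟩
  · rw [← hrep i, ← hrep j]
    exact hcl' _ _ h
  · rw [hrep]
    exact ((eF j).symm q).2
  · exact hC.comp σ.injective
  · rw [← hV]
    exact σ.iSup_comp (g := fun i => (C i).toSubmodule)

end Decomposition

end Leibniz

/-- The internal direct sum of a finite independent family of submodules. -/
theorem iSupIndep.exists_pi_linearEquiv {F L : Type*} [Field F] [AddCommGroup L] [Module F L]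
    {ι : Type*} [Fintype ι] {Y : ι → Submodule F L} (hY : iSupIndep Y) {V : Submodule F L}
    (hV : ⨆ i, Y i = V) :
    ∃ e : ((i : ι) → Y i) ≃ₗ[F] V, ∀ y, (e y : L) = ∑ i, (y i : L) := by
  classical
  let f : ((i : ι) → Y i) →ₗ[F] L := ∑ i, (Y i).subtype ∘ₗ LinearMap.proj i
  have hf : ∀ y, f y = ∑ i, (y i : L) := fun y => by simp [f]
  have hfV : ∀ y, f y ∈ V := fun y => by
    rw [hf, ← hV]
    exact sum_mem fun i _ => le_iSup Y i (y i).2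
  refine ⟨LinearEquiv.ofBijective (f.codRestrict V hfV) ⟨?_, ?_⟩, fun y => hf y⟩
  · rw [← LinearMap.ker_eq_bot, LinearMap.ker_codRestrict, LinearMap.ker_eq_bot']
    intro y hy
    rw [hf] at hy
    ext i
    exact (iSupIndep_iff_finsetSum_eq_zero_imp_eq_zero Y).1 hY Finset.univ (fun i => (y i : L))
      (fun i _ => (y i).2) hy i (Finset.mem_univ i)
  · rintro ⟨v, hv⟩
    have : v ∈ ⨆ i ∈ (Finset.univ : Finset ι), Y i := by simpa [hV] using hv
    obtain ⟨y, hy⟩ := (Submodule.mem_iSup_finset_iff_exists_sum Y v).1 this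
    exact ⟨y, Subtype.ext ((hf y).trans hy)⟩

namespace Leibniz

/-! ### Homomorphism spaces: additivity and Schur's lemma -/

section Hom

variable {F L : Type*} [Field F] [NonUnitalNonAssocRing L] [Module F L]
  {s : NonUnitalSubalgebra F L} {ι : Type*} [Fintype ι] {Y : ι → LeftSubmodule s}

/-- The components of a direct sum decomposition into submodules commute with the action. -/
theorem coe_symm_mul_apply {V : LeftSubmodule s}
    {e : ((i : ι) → (Y i).toSubmodule) ≃ₗ[F] V.toSubmodule}
    (he : ∀ y, (e y : L) = ∑ i, (y i : L)) (x : L) (hx : x ∈ s)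
    (v : V.toSubmodule) (i : ι) :
    (e.symm ⟨x * v, V.mul_mem' x hx v v.2⟩ i : L) = x * e.symm v i := by
  have : e.symm ⟨x * v, V.mul_mem' x hx v v.2⟩ =
      fun i => ⟨x * e.symm v i, (Y i).mul_mem' x hx _ (e.symm v i).2⟩ := by
    apply e.injective
    apply Subtype.ext
    rw [LinearEquiv.apply_symm_apply, he]
    simp only [← Finset.mul_sum, ← he, LinearEquiv.apply_symm_apply]
  rw [this]

variable [SMulCommClass F L L]

theorem mem_homS_iff {N P : LeftSubmodule s} {f : N.toSubmodule →ₗ[F] P.toSubmodule} :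
    f ∈ homS N P ↔ ∀ (x : L) (hx : x ∈ s) (n : N.toSubmodule),
      (f ⟨x * n, N.mul_mem' x hx n n.2⟩ : L) = x * f n :=
  forall_congr' fun _ => forall_congr' fun _ => forall_congr' fun _ => Subtype.ext_iff

instance (N P : LeftSubmodule s) : Module.Free F (homS N P) :=
  Module.Free.of_divisionRing F (homS N P)

instance [FiniteDimensional F L] (N P : LeftSubmodule s) : Module.Finite F (homS N P) :=
  inferInstanceAs (FiniteDimensional F (homS N P))

/-- Homomorphism spaces depend on the modules only up to isomorphism. -/
theorem finrank_homS_congr {N N' P P' : LeftSubmodule s} (hN : Isomorphic N N')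
    (hP : Isomorphic P P') :
    Module.finrank F (homS N P) = Module.finrank F (homS N' P') := by
  obtain ⟨e, he⟩ := hN
  obtain ⟨e', he'⟩ := hP
  refine LinearEquiv.finrank_eq ((LinearEquiv.arrowCongr e e').ofSubmodules _ _ ?_)
  ext f
  rw [Submodule.mem_map_equiv]
  refine ⟨fun h => ?_, fun h => mem_homS_comp (mem_homS_comp (mem_homS_symm he') h) he⟩
  have := mem_homS_comp (mem_homS_comp he' h) (mem_homS_symm he)
  convert this
  ext n
  simp

theorem finrank_homS_right (N : LeftSubmodule s) {V : LeftSubmodule s}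
    (hY : iSupIndep fun i => (Y i).toSubmodule) (hV : ⨆ i, (Y i).toSubmodule = V.toSubmodule)
    [FiniteDimensional F L] :
    Module.finrank F (homS N V) = ∑ i, Module.finrank F (homS N (Y i)) := by
  obtain ⟨e, he⟩ := hY.exists_pi_linearEquiv hV
  rw [← Module.finrank_pi_fintype]
  refine LinearEquiv.finrank_eq
    { toFun := fun f i => ⟨LinearMap.proj i ∘ₗ e.symm.toLinearMap ∘ₗ f.1, ?_⟩
      map_add' := fun f g => ?_
      map_smul' := fun c f => ?_
      invFun := fun g => ⟨e.toLinearMap ∘ₗ LinearMap.pi fun i => (g i).1, ?_⟩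
      left_inv := fun f => ?_
      right_inv := fun g => ?_ }
  · rw [mem_homS_iff]
    intro x hx n
    simp only [LinearMap.comp_apply, f.2 x hx n]
    exact coe_symm_mul_apply he x hx _ i
  · ext i n; simp
  · ext i n; simp
  · rw [mem_homS_iff]
    intro x hx n
    simp only [LinearMap.comp_apply, LinearEquiv.coe_coe, he, Finset.mul_sum, LinearMap.pi_apply]
    exact Finset.sum_congr rfl fun i _ => mem_homS_iff.1 (g i).2 x hx n
  · apply Subtype.ext
    ext n
    have : (LinearMap.pi fun i => LinearMap.proj i ∘ₗ e.symm.toLinearMap ∘ₗ f.1) n =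
      e.symm (f.1 n) := rfl
    rw [LinearMap.comp_apply, this]
    simp
  · ext i n
    simp

theorem finrank_homS_left (P : LeftSubmodule s) {V : LeftSubmodule s}
    (hY : iSupIndep fun i => (Y i).toSubmodule) (hV : ⨆ i, (Y i).toSubmodule = V.toSubmodule)
    [FiniteDimensional F L] :
    Module.finrank F (homS V P) = ∑ i, Module.finrank F (homS (Y i) P) := by
  classical
  obtain ⟨e, he⟩ := hY.exists_pi_linearEquiv hV
  have hle : ∀ i, (Y i).toSubmodule ≤ V.toSubmodule := fun i =>
    hV ▸ le_iSup (fun i => (Y i).toSubmodule) i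
  have hsingle : ∀ i (y : (Y i).toSubmodule),
      e.symm (Submodule.inclusion (hle i) y) = Pi.single i y := fun i y => by
    rw [LinearEquiv.symm_apply_eq]
    apply Subtype.ext
    rw [he, Finset.sum_eq_single i]
    · simp
    · intro j _ hj
      simp [Pi.single_eq_of_ne hj]
    · simp
  rw [← Module.finrank_pi_fintype]
  refine LinearEquiv.finrank_eq
    { toFun := fun f i => ⟨f.1 ∘ₗ Submodule.inclusion (hle i), ?_⟩
      map_add' := fun f g => ?_
      map_smul' := fun c f => ?_
      invFun := fun g => ⟨(∑ i, (g i).1 ∘ₗ LinearMap.proj i) ∘ₗ e.symm.toLinearMap, ?_⟩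
      left_inv := fun f => ?_
      right_inv := fun g => ?_ }
  · exact fun x hx n => f.2 x hx (Submodule.inclusion (hle i) n)
  · ext i n; simp
  · ext i n; simp
  · rw [mem_homS_iff]
    intro x hx n
    simp only [LinearMap.comp_apply, LinearMap.sum_apply, LinearEquiv.coe_coe,
      LinearMap.proj_apply, Submodule.coe_sum, Finset.mul_sum]
    refine Finset.sum_congr rfl fun i _ => ?_
    rw [← mem_homS_iff.1 (g i).2 x hx]
    congr 2
    exact Subtype.ext (coe_symm_mul_apply he x hx n i)
  · apply Subtype.ext
    apply LinearMap.ext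
    intro n
    obtain ⟨y, rfl⟩ := e.surjective n
    have : e y = ∑ i, Submodule.inclusion (hle i) (y i) := by
      apply Subtype.ext
      rw [he]
      simp
    conv_rhs => rw [this, map_sum]
    simp
  · ext i n
    simp only [LinearMap.comp_apply, LinearEquiv.coe_coe, hsingle, LinearMap.sum_apply,
      LinearMap.proj_apply]
    rw [Finset.sum_eq_single i]
    · simp
    · intro j _ hj
      simp [Pi.single_eq_of_ne hj]
    · simp

/-- **Schur's lemma** -/
theorem finrank_homS_eq_zero {N P : LeftSubmodule s} (hN : IsNontrivialIrreducible N)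
    (hP : IsNontrivialIrreducible P) (h : ¬ Isomorphic N P) :
    Module.finrank F (homS N P) = 0 := by
  have : Subsingleton (homS N P) := by
    refine subsingleton_of_forall_eq 0 fun ⟨f, hf⟩ => ?_
    let K : LeftSubmodule s :=
      { (LinearMap.ker f).map N.toSubmodule.subtype with
        mul_mem' := by
          rintro x hx _ ⟨n, hn, rfl⟩
          refine ⟨⟨x * n, N.mul_mem' x hx n n.2⟩, ?_, rfl⟩
          apply Subtype.ext
          rw [mem_homS_iff.1 hf x hx n, LinearMap.mem_ker.1 hn]
          simp }
    let R : LeftSubmodule s :=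
      { (LinearMap.range f).map P.toSubmodule.subtype with
        mul_mem' := by
          rintro x hx _ ⟨_, ⟨n, rfl⟩, rfl⟩
          exact ⟨_, ⟨⟨x * n, N.mul_mem' x hx n n.2⟩, rfl⟩, mem_homS_iff.1 hf x hx n⟩ }
    rcases hN.eq_bot_or_eq K (Submodule.map_subtype_le _ _) with hK | hK
    · rcases hP.eq_bot_or_eq R (Submodule.map_subtype_le _ _) with hR | hR
      · apply Subtype.ext
        ext n
        have : (f n : L) ∈ R.toSubmodule := ⟨f n, ⟨n, rfl⟩, rfl⟩
        rw [hR] at this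
        exact this
      · refine absurd ⟨LinearEquiv.ofBijective f ⟨?_, fun p => ?_⟩, hf⟩ h
        · rw [← LinearMap.ker_eq_bot]
          exact Submodule.map_injective_of_injective N.toSubmodule.subtype_injective
            (hK.trans (Submodule.map_bot _).symm)
        · have : (p : L) ∈ R.toSubmodule := by rw [hR]; exact p.2
          obtain ⟨_, ⟨n, rfl⟩, hn⟩ := this
          exact ⟨n, Subtype.ext hn⟩
    · apply Subtype.ext
      ext n
      have : (n : L) ∈ K.toSubmodule := by rw [hK]; exact n.2
      obtain ⟨m, hm, hmn⟩ := this
      obtain rfl : m = n := Subtype.ext hmn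
      simpa using hm
  exact Module.finrank_zero_of_subsingleton

end Hom

end Leibniz

namespace Leibniz

attribute [local instance] LieRing.ofAssociativeRing

/-! ### Derivations as inner part plus module homomorphisms -/

section Derivations

variable {F L : Type*} [Field F] [NonUnitalNonAssocRing L] [Module F L]

/-- A subalgebra as a left module over itself. -/
def selfModule (s : NonUnitalSubalgebra F L) : LeftSubmodule s :=
  { s.toSubmodule with mul_mem' := fun _ hx _ hy => s.mul_mem hx hy }

variable [SMulCommClass F L L]

/-- The Leibniz kernel as a left module over a subalgebra. -/
def kernelModule (hL : IsLeftLeibniz L) (s : NonUnitalSubalgebra F L) : LeftSubmodule s :=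
  { leibnizKernel F L with mul_mem' := fun x _ _ hy => mul_mem_leibnizKernel hL x hy }

variable [IsScalarTower F L L] {s : NonUnitalSubalgebra F L}

/-- The map takes values in the Leibniz kernel, so the term `E x * y` vanishes and the derivation
rule becomes `s`-linearity. -/
theorem ofIsCompl_mem_der (hL : IsLeftLeibniz L) (hs : IsCompl s.toSubmodule (leibnizKernel F L))
    (β : homS (selfModule s) (kernelModule hL s)) (γ : homS (kernelModule hL s) (kernelModule hL s)) :
    LinearMap.ofIsCompl hs ((leibnizKernel F L).subtype ∘ₗ β.1)
      ((leibnizKernel F L).subtype ∘ₗ γ.1) ∈ Der F L := by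
  set E := LinearMap.ofIsCompl hs ((leibnizKernel F L).subtype ∘ₗ β.1)
      ((leibnizKernel F L).subtype ∘ₗ γ.1) with hE
  have hβ : ∀ a : s.toSubmodule, E a = β.1 a := fun a => LinearMap.ofIsCompl_apply_left hs a
  have hγ : ∀ l : leibnizKernel F L, E l = γ.1 l := fun l => LinearMap.ofIsCompl_apply_right hs l
  have hmem : ∀ x, E x ∈ leibnizKernel F L := fun x => by
    obtain ⟨a, ha, l, hl, rfl⟩ := exists_add_of_isCompl hs x
    rw [map_add, hβ ⟨a, ha⟩, hγ ⟨l, hl⟩]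
    exact add_mem (β.1 ⟨a, ha⟩).2 (γ.1 ⟨l, hl⟩).2
  intro x y
  rw [leibnizKernel_mul_eq_zero hL (hmem x), zero_add]
  obtain ⟨t, ht, hx⟩ := exists_mem_mul_eq hL hs x
  obtain ⟨a, ha, l, hl, rfl⟩ := exists_add_of_isCompl hs y
  rw [hx, hx, mul_add, map_add, map_add, mul_add, hβ ⟨a, ha⟩, hγ ⟨l, hl⟩,
    hβ ⟨t * a, s.mul_mem ht ha⟩, hγ ⟨t * l, mul_mem_leibnizKernel hL t hl⟩]
  exact congrArg₂ (· + ·) (mem_homS_iff.1 β.2 t ht ⟨a, ha⟩) (mem_homS_iff.1 γ.2 t ht ⟨l, hl⟩)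

theorem mulLeft_mem_der (hL : IsLeftLeibniz L) (a : L) : LinearMap.mulLeft F a ∈ Der F L :=
  fun x y => hL a x y

/-- Derivations built from an inner derivation and equivariant maps to the Leibniz kernel. -/
noncomputable def toDer (hL : IsLeftLeibniz L) (hs : IsCompl s.toSubmodule (leibnizKernel F L)) :
    (s × homS (selfModule s) (kernelModule hL s) × homS (kernelModule hL s) (kernelModule hL s))
      →ₗ[F] Der F L where
  toFun u := ⟨_, add_mem (mulLeft_mem_der hL (u.1 : L)) (ofIsCompl_mem_der hL hs u.2.1 u.2.2)⟩
  map_add' u v := by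
    apply Subtype.ext
    ext x
    refine (congrArg₂ (· + ·) (add_mul (u.1 : L) v.1 x) (LinearMap.congr_fun
      (LinearMap.ofIsCompl_add hs (φ₁ := (leibnizKernel F L).subtype ∘ₗ u.2.1.1)
        (φ₂ := (leibnizKernel F L).subtype ∘ₗ v.2.1.1)
        (ψ₁ := (leibnizKernel F L).subtype ∘ₗ u.2.2.1)
        (ψ₂ := (leibnizKernel F L).subtype ∘ₗ v.2.2.1)) x)).trans ?_
    exact add_add_add_comm _ _ _ _
  map_smul' c u := by
    apply Subtype.ext
    ext x
    refine (congrArg₂ (· + ·) (smul_mul_assoc c (u.1 : L) x) (LinearMap.congr_fun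
      (LinearMap.ofIsCompl_smul hs c (φ := (leibnizKernel F L).subtype ∘ₗ u.2.1.1)
        (ψ := (leibnizKernel F L).subtype ∘ₗ u.2.2.1)) x)).trans ?_
    exact (smul_add _ _ _).symm

theorem toDer_apply_left (hL : IsLeftLeibniz L) (hs : IsCompl s.toSubmodule (leibnizKernel F L))
    (u) (x : L) (hx : x ∈ s) :
    (toDer hL hs u : L →ₗ[F] L) x = u.1 * x + (u.2.1.1 ⟨x, hx⟩ : L) :=
  congrArg ((u.1 : L) * x + ·) (LinearMap.ofIsCompl_apply_left hs ⟨x, hx⟩)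

theorem toDer_apply_right (hL : IsLeftLeibniz L) (hs : IsCompl s.toSubmodule (leibnizKernel F L))
    (u) (x : L) (hx : x ∈ leibnizKernel F L) :
    (toDer hL hs u : L →ₗ[F] L) x = u.1 * x + (u.2.2.1 ⟨x, hx⟩ : L) :=
  congrArg ((u.1 : L) * x + ·) (LinearMap.ofIsCompl_apply_right hs ⟨x, hx⟩)

variable [FiniteDimensional F L]

/-- If two triples give the same derivation, the difference `a` of their `s`-parts sends `s` into `s
∩ Leib(L) = 0`. Its image in the Lie algebra of left multiplications is then central, hence zero, so
`a = 0` and the remaining parts agree. -/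
theorem toDer_injective (hL : IsLeftLeibniz L) (hss : IsSemisimple F L)
    (hs : IsCompl s.toSubmodule (leibnizKernel F L)) : Function.Injective (toDer hL hs) := by
  intro u v huv
  let a : L := u.1 - v.1
  have has : a ∈ s := sub_mem u.1.2 v.1.2
  have h1 : ∀ x (hx : x ∈ s), a * x = v.2.1.1 ⟨x, hx⟩ - u.2.1.1 ⟨x, hx⟩ := fun x hx => by
    have := toDer_apply_left hL hs u x hx
    rw [huv, toDer_apply_left hL hs v x hx] at this
    rw [sub_mul, sub_eq_sub_iff_add_eq_add, add_comm (v.2.1.1 ⟨x, hx⟩ : L)]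
    exact this.symm
  have h2 : ∀ x (hx : x ∈ leibnizKernel F L), a * x = v.2.2.1 ⟨x, hx⟩ - u.2.2.1 ⟨x, hx⟩ :=
    fun x hx => by
      have := toDer_apply_right hL hs u x hx
      rw [huv, toDer_apply_right hL hs v x hx] at this
      rw [sub_mul, sub_eq_sub_iff_add_eq_add, add_comm (v.2.2.1 ⟨x, hx⟩ : L)]
      exact this.symm
  have hzero : ∀ x ∈ s, a * x = 0 := fun x hx => by
    refine Submodule.disjoint_def.1 hs.disjoint _ (s.mul_mem has hx) ?_
    rw [h1 x hx]
    exact sub_mem (v.2.1.1 ⟨x, hx⟩).2 (u.2.1.1 ⟨x, hx⟩).2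
  have ha : a = 0 := by
    refine Submodule.disjoint_def.1 hs.disjoint _ has ((toLeftMul_eq_zero_iff hL hss).1 ?_)
    have := hasTrivialRadical_leftMul hL hss
    have hc : toLeftMul F hL a ∈ LieAlgebra.center F (leftMul F hL) := by
      rw [LieModule.mem_maxTrivSubmodule]
      intro z
      obtain ⟨y, rfl⟩ := toLeftMul_surjective hL z
      obtain ⟨t, ht, hy⟩ := exists_mem_mul_eq hL hs y
      rw [← toLeftMul_mul, hy, mul_eq_neg_mul hs ht has, hzero t ht, neg_zero, map_zero]
    rwa [LieAlgebra.center_eq_bot, LieSubmodule.mem_bot] at hc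
  refine Prod.ext (Subtype.ext (sub_eq_zero.1 ha)) (Prod.ext ?_ ?_) <;> apply Subtype.ext <;>
    ext ⟨x, hx⟩
  · have := h1 x hx
    rw [ha, zero_mul, eq_comm, sub_eq_zero] at this
    exact this.symm
  · have := h2 x hx
    rw [ha, zero_mul, eq_comm, sub_eq_zero] at this
    exact this.symm

variable [CharZero F]

/-- Every derivation of a semisimple left Leibniz algebra is inner modulo the Leibniz kernel. -/
theorem exists_sub_mul_mem_leibnizKernel (hL : IsLeftLeibniz L) (hss : IsSemisimple F L)
    {D : L →ₗ[F] L} (hD : D ∈ Der F L) : ∃ w, ∀ x, D x - w * x ∈ leibnizKernel F L := by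
  have := hasTrivialRadical_leftMul hL hss
  -- The commutator with `D` sends the left multiplication by `x` to that by `D x`.
  let f₀ : leftMul F hL →ₗ[F] Module.End F L :=
    (LinearMap.mulLeft F (A := Module.End F L) D - LinearMap.mulRight F (A := Module.End F L) D) ∘ₗ
      (leftMul F hL).toSubmodule.subtype
  have hf₀ : ∀ x, f₀ (toLeftMul F hL x) = toLeftMul F hL (D x) := fun x => by
    ext y
    change D (x * y) - x * D y = D x * y
    rw [hD x y, add_sub_cancel_right]
  let f : leftMul F hL →ₗ[F] leftMul F hL := f₀.codRestrict (leftMul F hL).toSubmodule fun z => by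
    obtain ⟨x, rfl⟩ := toLeftMul_surjective hL z
    rw [hf₀]
    exact (toLeftMul F hL (D x)).2
  have hf : ∀ x, f (toLeftMul F hL x) = toLeftMul F hL (D x) := fun x => Subtype.ext (hf₀ x)
  obtain ⟨m, hm⟩ := LieModule.exists_eq_lie_of_cocycle f fun x y => by
    obtain ⟨x, rfl⟩ := toLeftMul_surjective hL x
    obtain ⟨y, rfl⟩ := toLeftMul_surjective hL y
    rw [← toLeftMul_mul, hf, hf, hf, hD x y, map_add, toLeftMul_mul, toLeftMul_mul,
      ← lie_skew (toLeftMul F hL (D x))]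
    abel
  obtain ⟨w, rfl⟩ := toLeftMul_surjective hL m
  -- Whitehead gives `D x ≡ x * w` modulo the kernel, and `x * w ≡ -(w * x)` there; hence the sign.
  refine ⟨-w, fun x => ?_⟩
  have h := hm (toLeftMul F hL x)
  rw [hf, ← toLeftMul_mul, ← sub_eq_zero, ← map_sub, toLeftMul_eq_zero_iff hL hss] at h
  have := add_mem h (mul_add_mul_mem_leibnizKernel (F := F) x w)
  convert this using 1
  rw [neg_mul]
  abel

/-- Removing the inner part leaves `E` with values in the kernel, so `E (x * y) = x * E y`; its
restrictions to `s` and to the kernel are the two homomorphisms sought. -/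
theorem toDer_surjective (hL : IsLeftLeibniz L) (hss : IsSemisimple F L)
    (hs : IsCompl s.toSubmodule (leibnizKernel F L)) : Function.Surjective (toDer hL hs) := by
  rintro ⟨D, hD⟩
  obtain ⟨w, hw⟩ := exists_sub_mul_mem_leibnizKernel hL hss hD
  obtain ⟨a, ha, hwa⟩ := exists_mem_mul_eq hL hs w
  let E : L →ₗ[F] L := D - LinearMap.mulLeft F a
  have hE : E ∈ Der F L := sub_mem hD (mulLeft_mem_der hL a)
  have hmem : ∀ x, E x ∈ leibnizKernel F L := fun x => by
    have := hw x
    rwa [hwa] at this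
  have hmul : ∀ x y, E (x * y) = x * E y := fun x y => by
    rw [hE x y, leibnizKernel_mul_eq_zero hL (hmem x), zero_add]
  let E' : L →ₗ[F] leibnizKernel F L := E.codRestrict _ hmem
  have hE' : ∀ x y, E' (x * y) = ⟨x * E' y, mul_mem_leibnizKernel hL x (E' y).2⟩ := fun x y =>
    Subtype.ext (hmul x y)
  refine ⟨⟨⟨a, ha⟩, ⟨E' ∘ₗ s.toSubmodule.subtype, fun x _ n => hE' x n⟩,
    ⟨E' ∘ₗ (leibnizKernel F L).subtype, fun x _ n => hE' x n⟩⟩, Subtype.ext ?_⟩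
  ext x
  obtain ⟨b, hb, l, hl, rfl⟩ := exists_add_of_isCompl hs x
  rw [map_add, map_add, toDer_apply_left hL hs _ b hb, toDer_apply_right hL hs _ l hl]
  change a * b + (D b - a * b) + (a * l + (D l - a * l)) = D b + D l
  abel

theorem finrank_der (hL : IsLeftLeibniz L) (hss : IsSemisimple F L)
    (hs : IsCompl s.toSubmodule (leibnizKernel F L)) :
    Module.finrank F (Der F L) = Module.finrank F s +
      (Module.finrank F (homS (selfModule s) (kernelModule hL s)) +
        Module.finrank F (homS (kernelModule hL s) (kernelModule hL s))) := by
  have : Module.Finite F s := inferInstanceAs (Module.Finite F s.toSubmodule)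
  rw [← Module.finrank_prod, ← Module.finrank_prod]
  exact (LinearEquiv.ofBijective (toDer hL hs)
    ⟨toDer_injective hL hss hs, toDer_surjective hL hss hs⟩).finrank_eq.symm

end Derivations

/-! ### Counting dimensions with multiplicities -/

section Multiplicities

variable {F L : Type*} [Field F] [NonUnitalNonAssocRing L] [Module F L] [SMulCommClass F L L]
  [FiniteDimensional F L] {s : NonUnitalSubalgebra F L}

theorem finrank_homS_of_isDecomposition {P Q : LeftSubmodule s → Prop} {V W : LeftSubmodule s}
    {p t : ℕ} {S : Fin p → LeftSubmodule s} {a : Fin p → ℕ} {M : Fin t → LeftSubmodule s}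
    {b : Fin t → ℕ} (hS : IsDecomposition P V.toSubmodule S a)
    (hM : IsDecomposition Q W.toSubmodule M b) :
    Module.finrank F (homS V W) = ∑ i, ∑ j, a i * b j * Module.finrank F (homS (S i) (M j)) := by
  obtain ⟨C, hC, hCi, hCV⟩ := hS.exists_copies
  obtain ⟨D, hD, hDi, hDW⟩ := hM.exists_copies
  obtain ⟨m, hm⟩ : ∃ m : Fin p → Fin t → ℕ,
    ∀ i j, Module.finrank F (homS (S i) (M j)) = m i j := ⟨_, fun _ _ => rfl⟩
  have h : ∀ (k : (i : Fin p) × Fin (a i)) (l : (j : Fin t) × Fin (b j)),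
      Module.finrank F (homS (C k.1 k.2) (D l.1 l.2)) = m k.1 l.1 :=
    fun k l => (finrank_homS_congr (hC _ _).2 (hD _ _).2).trans (hm _ _)
  rw [finrank_homS_left (Y := fun k : (i : Fin p) × Fin (a i) => C k.1 k.2) W hCi hCV]
  simp only [finrank_homS_right (Y := fun k : (j : Fin t) × Fin (b j) => D k.1 k.2) _ hDi hDW, h, hm]
  simp [Fintype.sum_sigma, Finset.mul_sum, mul_assoc]

end Multiplicities

end Leibniz

theorem theorem4p4 {F : Type*} {L : Type*} [Field F] [CharZero F]
    [NonUnitalNonAssocRing L] [Module F L] [IsScalarTower F L L] [SMulCommClass F L L]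
    [FiniteDimensional F L]
    (hL : Leibniz.IsLeftLeibniz L) (hss : Leibniz.IsSemisimple F L) :
    -- a Levi factor exists
    (∃ s : NonUnitalSubalgebra F L, IsCompl s.toSubmodule (Leibniz.leibnizKernel F L)) ∧
    -- for every Levi factor `s`
    ∀ s : NonUnitalSubalgebra F L, IsCompl s.toSubmodule (Leibniz.leibnizKernel F L) →
      -- the decompositions of `s` and of `Leib(L)` exist
      (∃ (p : ℕ) (S : Fin p → Leibniz.LeftSubmodule s) (a : Fin p → ℕ),
        Leibniz.IsDecomposition Leibniz.IsSimpleIdeal s.toSubmodule S a) ∧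
      (∃ (t : ℕ) (M : Fin t → Leibniz.LeftSubmodule s) (b : Fin t → ℕ),
        Leibniz.IsDecomposition Leibniz.IsNontrivialIrreducible
          (Leibniz.leibnizKernel F L) M b) ∧
      -- and any such decompositions compute `Der(L)`
      ∀ (p : ℕ) (S : Fin p → Leibniz.LeftSubmodule s) (a : Fin p → ℕ)
        (t : ℕ) (M : Fin t → Leibniz.LeftSubmodule s) (b : Fin t → ℕ),
        Leibniz.IsDecomposition Leibniz.IsSimpleIdeal s.toSubmodule S a →
        Leibniz.IsDecomposition Leibniz.IsNontrivialIrreducible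
          (Leibniz.leibnizKernel F L) M b →
        Nonempty (Leibniz.Der F L ≃ₗ[F]
          (s ×
            ((i : Fin p) → (j : Fin t) → Fin (a i * b j) → Leibniz.homS (S i) (M j)) ×
            ((k : Fin t) → Fin (b k ^ 2) → Leibniz.homS (M k) (M k)))) := by
  open Leibniz in
  refine ⟨exists_isCompl_leibnizKernel hL hss, fun s hs => ⟨?_, ?_, ?_⟩⟩
  · obtain ⟨n, C, hat, hle, hind, hsup⟩ := exists_iSupIndep_isAtom hL hss
      (leftIdeal hL s.toSubmodule fun x m hm => by
        obtain ⟨a, ha, h⟩ := exists_mem_mul_eq hL hs x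
        rw [h]
        exact s.mul_mem ha hm)
    exact exists_isDecomposition (fun i => ofLeftIdeal s (C i))
      (fun i => isSimpleIdeal_of_isAtom hss hs (hat i) (hle i)) hind hsup
  · obtain ⟨n, C, hat, hle, hind, hsup⟩ := exists_iSupIndep_isAtom hL hss
      (leftIdeal hL (leibnizKernel F L) fun x m hm => mul_mem_leibnizKernel hL x hm)
    exact exists_isDecomposition (fun i => ofLeftIdeal s (C i))
      (fun i => isNontrivialIrreducible_of_isAtom hss hs (hat i) (hle i)) hind hsup
  · intro p S a t M b hS hM
    have hfs : Module.Finite F s := inferInstanceAs (Module.Finite F s.toSubmodule)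
    -- Only a linear isomorphism is claimed, so equality of dimensions suffices.
    apply FiniteDimensional.nonempty_linearEquiv_of_finrank_eq
    rw [finrank_der hL hss hs, Module.finrank_prod, Module.finrank_prod,
      finrank_homS_of_isDecomposition (V := selfModule s) (W := kernelModule hL s) hS hM,
      finrank_homS_of_isDecomposition (V := kernelModule hL s) (W := kernelModule hL s) hM hM]
    simp only [Module.finrank_pi_fintype, Finset.sum_const, Finset.card_univ, Fintype.card_fin,
      smul_eq_mul]
    congr 2
    refine Finset.sum_congr rfl fun i _ => ?_
    -- By Schur's lemma only the diagonal terms survive, each with multiplicity `b i * b i`.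
    rw [Finset.sum_eq_single i, pow_two]
    · intro j _ hj
      rw [finrank_homS_eq_zero (hM.prop i) (hM.prop j) (hM.not_isomorphic i j hj.symm), mul_zero]
    · simp
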